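/- Consider $N$ consumers and $T$ time slots. The retailer has capacity $U$ and a cost function $C:[0,\infty)\to[0,\infty]$ with $C(0)=0$, such that $C$ is finite and differentiable on $[0,U)$ (one-sided at $0$), its derivative, the marginal cost $\mathcal C=C'$, is non-negative and non-decreasing, $C(U)=\lim_{x\uparrow U}C(x)\in[0,\infty]$, and $C(x)=\mathcal C(x)=\infty$ for $x>U$. (At $U$, $\mathcal C(U)\in[0,\infty]$ is any value for which $\mathcal C$ is non-decreasing on $[0,\infty)$.) Consumer $i$ chooses demands $x_i=(x_i^1,\dots,x_i^T)$ with $x_i^t\ge 0$ and $\sum_t x_i^t\ge\beta_i$, where $\beta_i\ge 0$ is its minimum daily requirement. Put $x^t=(x_1^t,\dots,x_N^t)$ and $X^t=\sum_i x_i^t$. In slot $t$ consumer $i$ pays - under average-cost pricing: $M_i^t(x^t)=x_i^t\,C(X^t)/X^t$ (and $0$ if $x_i^t=0$); - under time-variant increasing-block pricing: $M_i^t(x^t)=\int_0^{x_i^t}\mathcal C\big(\sum_j\min(s,x_j^t)\big)\,ds$. It earns $E_i^t=0$ in the zero-revenue model and $E_i^t=\omega_i^t x_i^t$, with constants $\omega_i^t\ge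 0$, in the constant-rate revenue model. Its payoff is $\pi_i(x)=\sum_t (E_i^t-M_i^t)\in[-\infty,\infty)$. A Nash equilibrium point (NEP) is a profile of admissible strategies at which no consumer can increase its payoff by changing only its own strategy to another admissible one. Then for each of the two pricing schemes: 1. (Zero revenue) If $\beta_i\ge0$ for all $i$ and $\sum_i\beta_i<TU$, the game has an NEP. 2. (Constant-rate revenue) If $\beta_i=0$ for all $i$, $\omega_i^t\ge 0$ for all $i,t$, and $0<TU$, the game has an NEP. In each case the NEP can be chosen with $X^t\le U$ for every $t$ and with all payments $M_i^t$ finite. -/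

import Mathlib

open scoped ENNReal

namespace LoadBalancing

/-- `C` is the retailer's cost function (with values in `[0, ∞]`) for a market of capacity `U`, and
`c` is the corresponding marginal cost function: `c = C'` wherever the load is below the capacity
(one-sided derivative at `0`), `c` is non-negative and non-decreasing, and both functions are
infinite above the capacity.  At the threshold `U` itself `C` is the limit from the left, which may
be finite or infinite.  Only the values at loads `x ≥ 0` are constrained. -/
structure IsCostFunction (U : ℝ) (C c : ℝ → ℝ≥0∞) : Prop where
  cost_zero : C 0 = 0
  cost_ne_top : ∀ x, 0 ≤ x → x < U → C x ≠ ⊤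
  marginal_ne_top : ∀ x, 0 ≤ x → x < U → c x ≠ ⊤
  hasDerivWithinAt : ∀ x, 0 ≤ x → x < U →
    HasDerivWithinAt (fun y : ℝ => (C y).toReal) (c x).toReal (Set.Ici 0) x
  marginal_mono : MonotoneOn c (Set.Ici 0)
  left_continuous : ContinuousWithinAt C (Set.Iic U) U
  cost_eq_top : ∀ x, U < x → C x = ⊤
  marginal_eq_top : ∀ x, U < x → c x = ⊤

variable {N T : ℕ}

/-- The total load of a demand vector `q` (the demands of all consumers in one time slot). -/
def load (q : Fin N → ℝ) : ℝ := ∑ j, q j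

/-- The average cost `A(X) = C(X) / X` of electricity. -/
noncomputable def averageCost (C : ℝ → ℝ≥0∞) (X : ℝ) : ℝ≥0∞ := C X / ENNReal.ofReal X

/-- Average-cost pricing: consumer `i` pays `q i * A(∑ j, q j)` (and nothing if `q i = 0`). -/
noncomputable def averageCostPayment (C : ℝ → ℝ≥0∞) (q : Fin N → ℝ) (i : Fin N) : ℝ≥0∞ :=
  ENNReal.ofReal (q i) * averageCost C (load q)

/-- The marginal cost function `M(s, q) = c (∑ j, min (s, q j))` posed to the consumers under
time-variant increasing-block pricing. -/
noncomputable def blockMarginal (c : ℝ → ℝ≥0∞) (s : ℝ) (q : Fin N → ℝ) : ℝ≥0∞ :=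
  c (∑ j, min s (q j))

/-- Time-variant increasing-block pricing: consumer `i` pays `∫_0^{q i} M(s, q) ds`. -/
noncomputable def increasingBlockPayment (c : ℝ → ℝ≥0∞) (q : Fin N → ℝ) (i : Fin N) : ℝ≥0∞ :=
  ∫⁻ s in Set.Ioc 0 (q i), blockMarginal c s q

/-- The two pricing schemes. -/
inductive PricingScheme where
  | averageCost
  | increasingBlock

/-- The payment of consumer `i` in a time slot with demand vector `q`. -/
noncomputable def PricingScheme.payment (s : PricingScheme) (C c : ℝ → ℝ≥0∞)
    (q : Fin N → ℝ) (i : Fin N) : ℝ≥0∞ :=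
  match s with
  | .averageCost => averageCostPayment C q i
  | .increasingBlock => increasingBlockPayment c q i

/-- The zero-revenue model. -/
def zeroRevenue (_ : Fin N) (_ : Fin T) (_ : ℝ) : ℝ := 0

/-- The constant-rate revenue model: in slot `t`, consumer `i` earns `ω i t` per unit. -/
def constantRateRevenue (ω : Fin N → Fin T → ℝ) (i : Fin N) (t : Fin T) (d : ℝ) : ℝ := ω i t * d

/-- The payoff `∑ t, (revenue - payment)` of consumer `i` at the demand profile `x`
(`x j t` is the demand of consumer `j` in slot `t`); it is `-∞` if some payment is infinite. -/
noncomputable def payoff (pay : (Fin N → ℝ) → Fin N → ℝ≥0∞) (rev : Fin N → Fin T → ℝ → ℝ)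
    (x : Fin N → Fin T → ℝ) (i : Fin N) : EReal :=
  ∑ t, (((rev i t (x i t) : ℝ) : EReal) - ((pay (fun j => x j t) i : ℝ≥0∞) : EReal))

/-- The strategies of a consumer with minimum total daily requirement `b`. -/
def strategySet (T : ℕ) (b : ℝ) : Set (Fin T → ℝ) :=
  {d | (∀ t, 0 ≤ d t) ∧ b ≤ ∑ t, d t}

/-- `x` is a Nash equilibrium point: every consumer plays a strategy from its strategy set, and no
consumer can raise its payoff by a unilateral change of strategy. -/
def IsNEP (pay : (Fin N → ℝ) → Fin N → ℝ≥0∞) (rev : Fin N → Fin T → ℝ → ℝ)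
    (β : Fin N → ℝ) (x : Fin N → Fin T → ℝ) : Prop :=
  (∀ i, x i ∈ strategySet T (β i)) ∧
    ∀ i, ∀ d ∈ strategySet T (β i),
      payoff pay rev (Function.update x i d) i ≤ payoff pay rev x i

/-- At `x` the load never exceeds the capacity `U`, and all payments are finite. -/
def IsServable (pay : (Fin N → ℝ) → Fin N → ℝ≥0∞) (U : ℝ) (x : Fin N → Fin T → ℝ) : Prop :=
  (∀ t, load (fun j => x j t) ≤ U) ∧ ∀ i t, pay (fun j => x j t) i ≠ ⊤

end LoadBalancing

namespace LoadBalancing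

open Set Filter Topology

variable {N T : ℕ}

/-! Payoffs are sums over slots, so it suffices to support each consumer's payment in each slot by a
line in its own demand; deviations with an infinite payment are worth `⊥` and need no bound. An
equilibrium of the linearized game is then a Nash equilibrium (`isNEP_of_isSupported`).

Zero revenue: play `β i / T` in every slot. The load is below `U`, so supporting slopes exist, and
they are non-negative.

Constant rate: the slots decouple, and each needs demands supported with slopes `ω i t`. No
fixed-point theorem is used. Under block pricing the marginal price of consumer `i` is
non-decreasing in its own demand, so `∑ j, min (q i) (q j)` only has to equal the load at which `c`
crosses `ω i`; `exists_sum_min_eq` solves these equations. Under average-cost pricing, let `a = C X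
/ X` and let `κ` be a subgradient of `C` at `X`. The slope is `a + (q i / X) * (κ - a)`. Equating it
to `ω i` for active consumers and summing leaves one scalar condition, `κ = a + ∑ i, max 0 (ω i -
a)`, which `exists_isSubgradient` solves for `X`. -/

/-- The affine function with slope `lam i` through the payment of consumer `i` at `q` is a lower
bound for its payment after any unilateral change of demand. -/
def IsSupported (pay : (Fin N → ℝ) → Fin N → ℝ≥0∞) (q lam : Fin N → ℝ) : Prop :=
  ∀ i, pay q i ≠ ⊤ ∧ ∀ d, 0 ≤ d → pay (Function.update q i d) i ≠ ⊤ →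
    (pay q i).toReal + lam i * (d - q i) ≤ (pay (Function.update q i d) i).toReal

/-! ### Reduction to supporting lines in single slots. -/

theorem slot_update (x : Fin N → Fin T → ℝ) (i : Fin N) (d : Fin T → ℝ) (t : Fin T) :
    (fun j => Function.update x i d j t) = Function.update (fun j => x j t) i (d t) := by
  funext j
  by_cases h : j = i
  · subst h; simp
  · simp [h]

theorem payoff_eq_coe {pay : (Fin N → ℝ) → Fin N → ℝ≥0∞} {rev : Fin N → Fin T → ℝ → ℝ}
    {x : Fin N → Fin T → ℝ} {i : Fin N} (h : ∀ t, pay (fun j => x j t) i ≠ ⊤) :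
    payoff pay rev x i =
      ((∑ t, (rev i t (x i t) - (pay (fun j => x j t) i).toReal) : ℝ) : EReal) := by
  have hcoe : ∀ f : Fin T → ℝ, ((∑ t, f t : ℝ) : EReal) = ∑ t, (f t : EReal) := fun f =>
    map_sum (⟨⟨fun a : ℝ => (a : EReal), EReal.coe_zero⟩, EReal.coe_add⟩ : ℝ →+ EReal) f _
  rw [payoff, hcoe]
  refine Finset.sum_congr rfl fun t _ => ?_
  rw [EReal.coe_sub, EReal.coe_ennreal_toReal (h t)]

theorem payoff_eq_bot {pay : (Fin N → ℝ) → Fin N → ℝ≥0∞} {rev : Fin N → Fin T → ℝ → ℝ}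
    {x : Fin N → Fin T → ℝ} {i : Fin N} {t : Fin T} (h : pay (fun j => x j t) i = ⊤) :
    payoff pay rev x i = ⊥ := by
  rw [payoff, ← Finset.add_sum_erase _ _ (Finset.mem_univ t), h]
  simp

/-- If every slot is supported with slopes `lam`, then a profile is a Nash equilibrium as soon as
no deviation gains in the game linearized with these slopes. -/
theorem isNEP_of_isSupported {pay : (Fin N → ℝ) → Fin N → ℝ≥0∞} {rev : Fin N → Fin T → ℝ → ℝ}
    {β : Fin N → ℝ} {x lam : Fin N → Fin T → ℝ}
    (hx : ∀ i, x i ∈ strategySet T (β i))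
    (hs : ∀ t, IsSupported pay (fun j => x j t) (fun j => lam j t))
    (hlin : ∀ i, ∀ d ∈ strategySet T (β i),
      ∑ t, (rev i t (d t) - lam i t * (d t - x i t)) ≤ ∑ t, rev i t (x i t)) :
    IsNEP pay rev β x := by
  refine ⟨hx, fun i d hd => ?_⟩
  by_cases htop : ∃ t, pay (fun j => Function.update x i d j t) i = ⊤
  · obtain ⟨t, ht⟩ := htop
    rw [payoff_eq_bot ht]
    exact bot_le
  · push Not at htop
    rw [payoff_eq_coe htop, payoff_eq_coe fun t => (hs t i).1, EReal.coe_le_coe_iff]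
    have hle : ∀ t, lam i t * (d t - x i t) + (pay (fun j => x j t) i).toReal ≤
        (pay (fun j => Function.update x i d j t) i).toReal := by
      intro t
      have h := htop t
      rw [slot_update] at h ⊢
      linarith [(hs t i).2 (d t) (hd.1 t) h]
    have hsum := Finset.sum_le_sum fun t (_ : t ∈ Finset.univ) => hle t
    have hl := hlin i d hd
    simp only [Finset.sum_add_distrib, Finset.sum_sub_distrib, Function.update_self] at *
    linarith

/-- Under the even split a consumer's slope is the same in every slot, so the linearized cost of a
deviation depends only on its daily total, which is at least `β i`. -/
theorem exists_zeroRevenue_nep {pay : (Fin N → ℝ) → Fin N → ℝ≥0∞} {U : ℝ} {β lam : Fin N → ℝ}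
    (hT : 0 < T) (hβ : ∀ i, 0 ≤ β i) (hsum : ∑ i, β i < T * U) (hlam : ∀ i, 0 ≤ lam i)
    (hs : IsSupported pay (fun i => β i / T) lam) :
    ∃ x : Fin N → Fin T → ℝ, IsNEP pay zeroRevenue β x ∧ IsServable pay U x := by
  have hT' : (0 : ℝ) < T := Nat.cast_pos.2 hT
  refine ⟨fun i _ => β i / T, isNEP_of_isSupported (lam := fun i _ => lam i) ?_ (fun _ => hs) ?_,
    fun t => ?_, fun i t => (hs i).1⟩
  · refine fun i => ⟨fun t => div_nonneg (hβ i) hT'.le, ?_⟩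
    simp [mul_div_cancel₀ _ hT'.ne']
  · intro i d hd
    have h : 0 ≤ lam i * (∑ t, d t - β i) := mul_nonneg (hlam i) (sub_nonneg.2 hd.2)
    simp only [zeroRevenue, zero_sub, Finset.sum_neg_distrib, ← Finset.mul_sum,
      Finset.sum_sub_distrib, Finset.sum_const, Finset.card_univ, Fintype.card_fin, nsmul_eq_mul,
      mul_div_cancel₀ _ hT'.ne', mul_zero]
    linarith
  · rw [load, ← Finset.sum_div, div_le_iff₀ hT']
    linarith

theorem exists_constantRate_nep {pay : (Fin N → ℝ) → Fin N → ℝ≥0∞} {U : ℝ}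
    {ω : Fin N → Fin T → ℝ}
    (h : ∀ t, ∃ q : Fin N → ℝ, (∀ i, 0 ≤ q i) ∧ load q ≤ U ∧ IsSupported pay q (fun i => ω i t)) :
    ∃ x : Fin N → Fin T → ℝ,
      IsNEP pay (constantRateRevenue ω) (fun _ => 0) x ∧ IsServable pay U x := by
  choose q hq hload hs using h
  refine ⟨fun i t => q t i, isNEP_of_isSupported (lam := ω) ?_ hs ?_, hload,
    fun i t => (hs t i).1⟩
  · exact fun i => ⟨fun t => hq t i, Finset.sum_nonneg fun t _ => hq t i⟩
  · intro i d _
    -- With slope `ω` the linearized payoff does not depend on the deviation.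
    refine le_of_eq (Finset.sum_congr rfl fun t _ => ?_)
    simp only [constantRateRevenue]
    ring

/-! ### Increasing-block pricing -/

theorem sum_min_update {q : Fin N → ℝ} {i : Fin N} {s d : ℝ} (hs : s ≤ d) :
    ∑ j, min s (Function.update q i d j) = s + ∑ j ∈ Finset.univ.erase i, min s (q j) := by
  rw [← Finset.add_sum_erase _ _ (Finset.mem_univ i), Function.update_self, min_eq_left hs]
  congr 1
  refine Finset.sum_congr rfl fun j hj => ?_
  rw [Function.update_of_ne (Finset.ne_of_mem_erase hj)]

/-- The new integrand no longer involves `d`: own demand enters only as the upper limit of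
integration. -/
theorem increasingBlockPayment_update (c : ℝ → ℝ≥0∞) (q : Fin N → ℝ) (i : Fin N) (d : ℝ) :
    increasingBlockPayment c (Function.update q i d) i =
      ∫⁻ s in Ioc 0 d, c (s + ∑ j ∈ Finset.univ.erase i, min s (q j)) := by
  rw [increasingBlockPayment, Function.update_self]
  refine MeasureTheory.setLIntegral_congr_fun measurableSet_Ioc fun s hs => ?_
  simp only [blockMarginal, sum_min_update hs.2]

theorem lintegral_Ioc_add_adjacent (f : ℝ → ℝ≥0∞) {a b : ℝ} (ha : 0 ≤ a) (hab : a ≤ b) :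
    ∫⁻ s in Ioc 0 b, f s = (∫⁻ s in Ioc 0 a, f s) + ∫⁻ s in Ioc a b, f s := by
  rw [← Ioc_union_Ioc_eq_Ioc ha hab,
    MeasureTheory.lintegral_union measurableSet_Ioc (Ioc_disjoint_Ioc_of_le le_rfl)]

theorem lintegral_Ioc_le {f : ℝ → ℝ≥0∞} {a b l : ℝ} (hl : 0 ≤ l)
    (h : ∀ s ∈ Ioo a b, f s ≤ ENNReal.ofReal l) :
    ∫⁻ s in Ioc a b, f s ≤ ENNReal.ofReal (l * (b - a)) := by
  -- The right endpoint is dropped because the price there may be infinite.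
  rw [← MeasureTheory.setLIntegral_congr MeasureTheory.Ioo_ae_eq_Ioc]
  refine (MeasureTheory.setLIntegral_mono measurable_const h).trans (le_of_eq ?_)
  rw [MeasureTheory.setLIntegral_const, Real.volume_Ioo, ENNReal.ofReal_mul hl]

theorem le_lintegral_Ioc {f : ℝ → ℝ≥0∞} {a b l : ℝ} (hl : 0 ≤ l)
    (h : ∀ s ∈ Ioc a b, ENNReal.ofReal l ≤ f s) :
    ENNReal.ofReal (l * (b - a)) ≤ ∫⁻ s in Ioc a b, f s := by
  refine le_trans (le_of_eq ?_) (MeasureTheory.setLIntegral_mono' measurableSet_Ioc h)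
  rw [MeasureTheory.setLIntegral_const, Real.volume_Ioc, ENNReal.ofReal_mul hl]

theorem isSupported_increasingBlock {c : ℝ → ℝ≥0∞} {q lam : Fin N → ℝ}
    (hq : ∀ i, 0 ≤ q i) (hlam : ∀ i, 0 ≤ lam i)
    (hlow : ∀ i s, 0 < s → s < q i →
      c (s + ∑ j ∈ Finset.univ.erase i, min s (q j)) ≤ ENNReal.ofReal (lam i))
    (hhigh : ∀ i s, q i < s →
      ENNReal.ofReal (lam i) ≤ c (s + ∑ j ∈ Finset.univ.erase i, min s (q j))) :
    IsSupported (increasingBlockPayment c) q lam := by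
  intro i
  set f : ℝ → ℝ≥0∞ := fun s => c (s + ∑ j ∈ Finset.univ.erase i, min s (q j))
  have hpay : increasingBlockPayment c q i = ∫⁻ s in Ioc 0 (q i), f s := by
    conv_lhs => rw [← Function.update_eq_self i q]
    exact increasingBlockPayment_update c q i (q i)
  have hfin : increasingBlockPayment c q i ≠ ⊤ := by
    rw [hpay]
    exact ne_top_of_le_ne_top ENNReal.ofReal_ne_top
      (lintegral_Ioc_le (hlam i) fun s hs => hlow i s hs.1 hs.2)
  refine ⟨hfin, fun d hd htop => ?_⟩
  rw [increasingBlockPayment_update] at htop ⊢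
  rw [hpay] at hfin ⊢
  rcases le_total d (q i) with hdq | hdq
  · have h1 := lintegral_Ioc_add_adjacent f hd hdq
    have h2 : ∫⁻ s in Ioc d (q i), f s ≤ ENNReal.ofReal (lam i * (q i - d)) :=
      lintegral_Ioc_le (hlam i) fun s hs => hlow i s (hd.trans_lt hs.1) hs.2
    have h3 := ENNReal.toReal_le_of_le_ofReal
      (mul_nonneg (hlam i) (sub_nonneg.2 hdq)) h2
    rw [h1, ENNReal.toReal_add htop (ne_top_of_le_ne_top ENNReal.ofReal_ne_top h2)]
    linarith
  · have h1 := lintegral_Ioc_add_adjacent f (hq i) hdq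
    have h2 : ENNReal.ofReal (lam i * (d - q i)) ≤ ∫⁻ s in Ioc (q i) d, f s :=
      le_lintegral_Ioc (hlam i) fun s hs => hhigh i s hs.1
    change ∫⁻ s in Ioc 0 d, f s ≠ ⊤ at htop
    change _ ≤ (∫⁻ s in Ioc 0 d, f s).toReal
    rw [h1] at htop ⊢
    have htop' := ENNReal.add_ne_top.1 htop
    have h3 := (ENNReal.ofReal_le_iff_le_toReal htop'.2).1 h2
    rw [ENNReal.toReal_add htop'.1 htop'.2]
    linarith

/-- Water-filling: everybody receives the base level `y k / s.card` of the smallest target `y k`,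
and the residual targets `y i - y k` are met recursively without `k`. -/
theorem exists_sum_min_eq {ι : Type*} [DecidableEq ι] (s : Finset ι) :
    ∀ y : ι → ℝ, (∀ i ∈ s, 0 ≤ y i) →
      ∃ q : ι → ℝ, (∀ i ∈ s, 0 ≤ q i) ∧ ∀ i ∈ s, ∑ j ∈ s, min (q i) (q j) = y i := by
  induction s using Finset.strongInduction with
  | H s ih =>
    intro y hy
    rcases s.eq_empty_or_nonempty with rfl | hne
    · exact ⟨0, by simp, by simp⟩
    obtain ⟨k, hk, hmin⟩ := s.exists_min_image y hne
    obtain ⟨p, hp, hpy⟩ := ih _ (Finset.erase_ssubset hk) (fun i => y i - y k)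
      fun i hi => sub_nonneg.2 (hmin i (Finset.mem_of_mem_erase hi))
    have hcard : (0 : ℝ) < s.card := Nat.cast_pos.2 hne.card_pos
    set m : ℝ := y k / s.card with hm
    have hcm : s.card * m = y k := by rw [hm]; field_simp
    have hm0 : 0 ≤ m := div_nonneg (hy k hk) hcard.le
    set r : ι → ℝ := Function.update p k 0
    have hr : ∀ i ∈ s, 0 ≤ r i := by
      intro i hi
      by_cases h : i = k
      · simp [r, h]
      · simpa [r, h] using hp i (Finset.mem_erase.2 ⟨h, hi⟩)
    refine ⟨fun i => m + r i, fun i hi => add_nonneg hm0 (hr i hi), fun i hi => ?_⟩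
    simp only [min_add_add_left, Finset.sum_add_distrib, Finset.sum_const, nsmul_eq_mul, hcm]
    by_cases h : i = k
    · subst h
      have : ∑ j ∈ s, min (r i) (r j) = 0 :=
        Finset.sum_eq_zero fun j hj => by
          have := hr j hj
          simpa [r] using this
      rw [this, add_zero]
    · have hi' := Finset.mem_erase.2 ⟨h, hi⟩
      rw [← Finset.add_sum_erase _ _ hk, min_eq_right (by simpa [r] using hr i hi)]
      have : ∑ j ∈ s.erase k, min (r i) (r j) = y i - y k := by
        rw [← hpy i hi']
        refine Finset.sum_congr rfl fun j hj => ?_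
        simp [r, h, Finset.ne_of_mem_erase hj]
      rw [this]
      simp [r]

theorem exists_marginal_threshold {U : ℝ} (hU : 0 < U) {c : ℝ → ℝ≥0∞}
    (hmono : MonotoneOn c (Ici 0)) (htop : ∀ x, U < x → c x = ⊤) (a : ℝ≥0∞) :
    ∃ y, 0 ≤ y ∧ y ≤ U ∧ (∀ z, 0 ≤ z → z < y → c z ≤ a) ∧ ∀ z, y < z → a ≤ c z := by
  set S : Set ℝ := {z | 0 ≤ z ∧ z ≤ U ∧ c z ≤ a}
  have hbdd : BddAbove S := ⟨U, fun z hz => hz.2.1⟩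
  -- If `S` is empty, `sSup S = 0` is still the right threshold.
  have hy0 : 0 ≤ sSup S := Real.sSup_nonneg fun z hz => hz.1
  refine ⟨sSup S, hy0, Real.sSup_le (fun z hz => hz.2.1) hU.le, fun z hz hzy => ?_, fun z hz => ?_⟩
  · have hne : S.Nonempty := by
      by_contra h
      rw [not_nonempty_iff_eq_empty.1 h, Real.sSup_empty] at hzy
      linarith
    obtain ⟨w, hw, hzw⟩ := exists_lt_of_lt_csSup hne hzy
    exact (hmono hz hw.1 hzw.le).trans hw.2.2
  · rcases le_or_gt z U with hzU | hzU
    · by_contra h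
      exact hz.not_ge (le_csSup hbdd ⟨hy0.trans hz.le, hzU, (not_le.1 h).le⟩)
    · rw [htop z hzU]
      exact le_top

theorem add_sum_erase_min_self (q : Fin N → ℝ) (i : Fin N) :
    q i + ∑ j ∈ Finset.univ.erase i, min (q i) (q j) = ∑ j, min (q i) (q j) := by
  rw [← Finset.add_sum_erase _ _ (Finset.mem_univ i), min_self]

theorem sum_erase_min_mono (q : Fin N → ℝ) (i : Fin N) {s s' : ℝ} (h : s ≤ s') :
    ∑ j ∈ Finset.univ.erase i, min s (q j) ≤ ∑ j ∈ Finset.univ.erase i, min s' (q j) :=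
  Finset.sum_le_sum fun _ _ => min_le_min_right _ h

theorem sum_erase_min_nonneg {q : Fin N → ℝ} (hq : ∀ i, 0 ≤ q i) (i : Fin N) {s : ℝ}
    (h : 0 ≤ s) : 0 ≤ ∑ j ∈ Finset.univ.erase i, min s (q j) :=
  Finset.sum_nonneg fun j _ => le_min h (hq j)

theorem exists_increasingBlock_equilibrium {U : ℝ} (hU : 0 < U) {c : ℝ → ℝ≥0∞}
    (hmono : MonotoneOn c (Ici 0)) (htop : ∀ x, U < x → c x = ⊤) {ω : Fin N → ℝ}
    (hω : ∀ i, 0 ≤ ω i) :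
    ∃ q : Fin N → ℝ, (∀ i, 0 ≤ q i) ∧ load q ≤ U ∧
      IsSupported (increasingBlockPayment c) q ω := by
  choose y hy0 hyU hlow hhigh using
    fun i => exists_marginal_threshold hU hmono htop (ENNReal.ofReal (ω i))
  obtain ⟨q, hq, hqy⟩ := exists_sum_min_eq Finset.univ y fun i _ => hy0 i
  simp only [Finset.mem_univ, true_implies] at hq hqy
  refine ⟨q, hq, ?_, isSupported_increasingBlock hq hω (fun i s hs hsq => ?_) fun i s hs => ?_⟩
  · rcases isEmpty_or_nonempty (Fin N) with h | h
    · simpa [load] using hU.le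
    · obtain ⟨k, hk⟩ := Finite.exists_max q
      -- For the largest demand, every minimum with `q k` is the other demand itself.
      have : load q = y k := by
        rw [load, ← hqy k]
        exact Finset.sum_congr rfl fun j _ => (min_eq_right (hk j)).symm
      rw [this]
      exact hyU k
  · refine hlow i _ (add_nonneg hs.le (sum_erase_min_nonneg hq i hs.le)) ?_
    rw [← hqy i, ← add_sum_erase_min_self]
    exact add_lt_add_of_lt_of_le hsq (sum_erase_min_mono q i hsq.le)
  · refine hhigh i _ ?_
    rw [← hqy i, ← add_sum_erase_min_self]
    exact add_lt_add_of_lt_of_le hs (sum_erase_min_mono q i hs.le)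

theorem exists_isSupported_increasingBlock {U : ℝ} {C c : ℝ → ℝ≥0∞} (hC : IsCostFunction U C c)
    {q : Fin N → ℝ} (hq : ∀ i, 0 ≤ q i) (hload : load q < U) :
    ∃ lam : Fin N → ℝ, (∀ i, 0 ≤ lam i) ∧ IsSupported (increasingBlockPayment c) q lam := by
  have h0 : ∀ i, 0 ≤ q i + ∑ j ∈ Finset.univ.erase i, min (q i) (q j) := fun i =>
    add_nonneg (hq i) (sum_erase_min_nonneg hq i (hq i))
  have htop : ∀ i, c (q i + ∑ j ∈ Finset.univ.erase i, min (q i) (q j)) ≠ ⊤ := by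
    refine fun i => hC.marginal_ne_top _ (h0 i) (lt_of_le_of_lt ?_ hload)
    rw [add_sum_erase_min_self]
    exact Finset.sum_le_sum fun j _ => min_le_right _ _
  refine ⟨fun i => (c (q i + ∑ j ∈ Finset.univ.erase i, min (q i) (q j))).toReal,
    fun i => ENNReal.toReal_nonneg, isSupported_increasingBlock hq
      (fun i => ENNReal.toReal_nonneg) (fun i s hs hsq => ?_) fun i s hs => ?_⟩
  · rw [ENNReal.ofReal_toReal (htop i)]
    exact hC.marginal_mono (add_nonneg hs.le (sum_erase_min_nonneg hq i hs.le)) (h0 i)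
      (add_le_add hsq.le (sum_erase_min_mono q i hsq.le))
  · rw [ENNReal.ofReal_toReal (htop i)]
    exact hC.marginal_mono (h0 i)
      (add_nonneg ((hq i).trans hs.le) (sum_erase_min_nonneg hq i ((hq i).trans hs.le)))
      (add_le_add hs.le (sum_erase_min_mono q i hs.le))

/-! ### Average-cost pricing -/

/-- `κ` is a subgradient at `X` of the extended-valued function `C` on `[0, ∞)`. -/
def IsSubgradient (C : ℝ → ℝ≥0∞) (X κ : ℝ) : Prop :=
  C X ≠ ⊤ ∧ ∀ Z, 0 ≤ Z → C Z ≠ ⊤ → (C X).toReal + κ * (Z - X) ≤ (C Z).toReal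

/-! ### Convexity of the cost function and its subgradients. -/

namespace IsCostFunction

variable {U : ℝ} {C c : ℝ → ℝ≥0∞}

theorem continuousOn_toReal (hC : IsCostFunction U C c) :
    ContinuousOn (fun y => (C y).toReal) (Ico 0 U) := fun x hx =>
  (hC.hasDerivWithinAt x hx.1 hx.2).continuousWithinAt.mono Ico_subset_Ici_self

theorem exists_marginal_eq_slope (hC : IsCostFunction U C c) {a b : ℝ} (ha : 0 ≤ a) (hab : a < b)
    (hb : b < U) :
    ∃ x ∈ Ioo a b, (c x).toReal * (b - a) = (C b).toReal - (C a).toReal := by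
  obtain ⟨x, hx, h⟩ := exists_hasDerivAt_eq_slope (fun y => (C y).toReal)
    (fun y => (c y).toReal) hab
    (hC.continuousOn_toReal.mono fun y hy => ⟨ha.trans hy.1, hy.2.trans_lt hb⟩)
    fun y hy => (hC.hasDerivWithinAt y (ha.trans hy.1.le) (hy.2.trans hb)).hasDerivAt
      (Ici_mem_nhds (ha.trans_lt hy.1))
  exact ⟨x, hx, by rw [h, div_mul_cancel₀ _ (sub_pos.2 hab).ne']⟩

theorem marginal_toReal_mono (hC : IsCostFunction U C c) {a b : ℝ} (ha : 0 ≤ a) (hab : a ≤ b)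
    (hb : b < U) : (c a).toReal ≤ (c b).toReal :=
  ENNReal.toReal_mono (hC.marginal_ne_top b (ha.trans hab) hb)
    (hC.marginal_mono ha (ha.trans hab) hab)

theorem add_marginal_mul_le (hC : IsCostFunction U C c) {X Z : ℝ} (hX0 : 0 ≤ X) (hX : X < U)
    (hZ0 : 0 ≤ Z) (hZ : Z < U) :
    (C X).toReal + (c X).toReal * (Z - X) ≤ (C Z).toReal := by
  rcases lt_trichotomy X Z with h | rfl | h
  · obtain ⟨x, hx, hs⟩ := hC.exists_marginal_eq_slope hX0 h hZ
    have := mul_le_mul_of_nonneg_right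
      (hC.marginal_toReal_mono hX0 hx.1.le (hx.2.trans hZ)) (sub_pos.2 h).le
    linarith
  · simp
  · obtain ⟨x, hx, hs⟩ := hC.exists_marginal_eq_slope hZ0 h hX
    have := mul_le_mul_of_nonneg_right
      (hC.marginal_toReal_mono (hZ0.trans hx.1.le) hx.2.le hX) (sub_pos.2 h).le
    linarith

theorem tendsto_left (hC : IsCostFunction U C c) : Tendsto C (𝓝[<] U) (𝓝 (C U)) :=
  hC.left_continuous.mono_left (nhdsWithin_mono _ Iio_subset_Iic_self)

theorem tendsto_toReal_left (hC : IsCostFunction U C c) (hfin : C U ≠ ⊤) :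
    Tendsto (fun y => (C y).toReal) (𝓝[<] U) (𝓝 (C U).toReal) :=
  (ENNReal.tendsto_toReal hfin).comp hC.tendsto_left

/-- A lower bound by an affine function below the capacity extends to all loads. -/
theorem affine_le (hC : IsCostFunction U C c) {a b X : ℝ} (hX : X < U)
    (h : ∀ Z, X < Z → Z < U → a + b * (Z - X) ≤ (C Z).toReal)
    {Z : ℝ} (hXZ : X < Z) (htop : C Z ≠ ⊤) :
    a + b * (Z - X) ≤ (C Z).toReal := by
  rcases lt_trichotomy Z U with hZ | rfl | hZ
  · exact h Z hXZ hZ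
  · have hlim : Tendsto (fun y => a + b * (y - X)) (𝓝[<] Z) (𝓝 (a + b * (Z - X))) :=
      (Continuous.tendsto (by fun_prop) Z).mono_left nhdsWithin_le_nhds
    refine le_of_tendsto_of_tendsto hlim (hC.tendsto_toReal_left htop) ?_
    filter_upwards [Ioo_mem_nhdsLT hX] with y hy using h y hy.1 hy.2
  · exact absurd (hC.cost_eq_top Z hZ) htop

theorem isSubgradient_marginal (hC : IsCostFunction U C c) {X : ℝ} (hX0 : 0 ≤ X) (hX : X < U) :
    IsSubgradient C X (c X).toReal := by
  refine ⟨hC.cost_ne_top X hX0 hX, fun Z hZ0 htop => ?_⟩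
  rcases le_or_gt Z X with h | h
  · exact hC.add_marginal_mul_le hX0 hX hZ0 (h.trans_lt hX)
  · exact hC.affine_le hX
      (fun Y hY hYU => hC.add_marginal_mul_le hX0 hX (hX0.trans hY.le) hYU) h htop

theorem tendsto_average_zero (hC : IsCostFunction U C c) (hU : 0 < U) :
    Tendsto (fun y => (C y).toReal / y) (𝓝[>] 0) (𝓝 (c 0).toReal) := by
  have h := ((hC.hasDerivWithinAt 0 le_rfl hU).mono Ioi_subset_Ici_self)
  rw [hasDerivWithinAt_iff_tendsto_slope' self_notMem_Ioi] at h
  refine h.congr fun y => ?_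
  simp [slope_def_field, hC.cost_zero]

theorem le_marginal_zero (hC : IsCostFunction U C c) (hU : 0 < U) {κ : ℝ}
    (h : ∀ Z, 0 < Z → Z < U → κ * Z ≤ (C Z).toReal) : κ ≤ (c 0).toReal := by
  refine ge_of_tendsto (hC.tendsto_average_zero hU) ?_
  filter_upwards [Ioo_mem_nhdsGT hU] with y hy
  exact (le_div_iff₀ hy.1).2 (h y hy.1 hy.2)

theorem average_le_marginal (hC : IsCostFunction U C c) {X : ℝ} (hX0 : 0 < X) (hX : X < U) :
    (C X).toReal / X ≤ (c X).toReal := by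
  have h := hC.add_marginal_mul_le hX0.le hX le_rfl (hX0.trans hX)
  rw [hC.cost_zero, ENNReal.toReal_zero] at h
  rw [div_le_iff₀ hX0]
  linarith

/-- If the marginal cost below the load `X` is at most a continuous function `Ψ` of the average
cost, then the value of `Ψ` at `X` bounds the cost from below as a subgradient from the left. -/
theorem le_of_marginal_le (hC : IsCostFunction U C c) {Ψ : ℝ → ℝ} (hΨ : Continuous Ψ) {X : ℝ}
    (hX0 : 0 < X) (hXU : X ≤ U)
    (hlim : Tendsto (fun y => (C y).toReal) (𝓝[<] X) (𝓝 (C X).toReal))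
    (hle : ∀ Y, 0 < Y → Y < X → (c Y).toReal ≤ Ψ ((C Y).toReal / Y)) {Z : ℝ} (hZ0 : 0 ≤ Z)
    (hZ : Z < X) : (C X).toReal + Ψ ((C X).toReal / X) * (Z - X) ≤ (C Z).toReal := by
  have hid : Tendsto (fun y : ℝ => y) (𝓝[<] X) (𝓝 X) := nhdsWithin_le_nhds
  have hA := (hΨ.tendsto _).comp (hlim.div hid hX0.ne')
  refine le_of_tendsto (hlim.add (hA.mul (hid.const_sub Z))) ?_
  filter_upwards [Ioo_mem_nhdsLT hZ] with y hy
  have h1 := hC.add_marginal_mul_le (hZ0.trans hy.1.le) (hy.2.trans_le hXU) hZ0 (hZ.trans_le hXU)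
  have h2 := mul_le_mul_of_nonneg_right (hle y (hZ0.trans_lt hy.1) hy.2) (sub_pos.2 hy.1).le
  simp only [Function.comp_apply, Pi.div_apply]
  linarith

/-- The average is at most the marginal, which is below `Ψ` of the average; as `Ψ a ≤ a` from `W`
on, the average stays below `W`. Hence `C U` is finite, and above `U` there is nothing to check. -/
theorem exists_isSubgradient_of_forall_lt (hC : IsCostFunction U C c) (hU : 0 < U) {Ψ : ℝ → ℝ}
    (hΨ : Continuous Ψ) {W : ℝ} (hW : ∀ a, W ≤ a → Ψ a ≤ a)
    (hlt : ∀ Y, 0 < Y → Y < U → (c Y).toReal < Ψ ((C Y).toReal / Y)) :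
    IsSubgradient C U (Ψ ((C U).toReal / U)) := by
  have hbound : ∀ Y, 0 < Y → Y < U → C Y ≤ ENNReal.ofReal (|W| * U) := by
    intro Y hY hYU
    rw [← ENNReal.ofReal_toReal (hC.cost_ne_top Y hY.le hYU)]
    refine ENNReal.ofReal_le_ofReal ?_
    have hA : (C Y).toReal / Y ≤ |W| := by
      by_contra! h
      exact ((hC.average_le_marginal hY hYU).trans_lt (hlt Y hY hYU)).not_ge
        (hW _ ((le_abs_self W).trans h.le))
    exact ((div_le_iff₀ hY).1 hA).trans (mul_le_mul_of_nonneg_left hYU.le (abs_nonneg W))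
  have hfin : C U ≠ ⊤ := by
    refine ne_top_of_le_ne_top ENNReal.ofReal_ne_top (le_of_tendsto hC.tendsto_left ?_)
      (b := ENNReal.ofReal (|W| * U))
    filter_upwards [Ioo_mem_nhdsLT hU] with Y hY using hbound Y hY.1 hY.2
  refine ⟨hfin, fun Z hZ0 htop => ?_⟩
  rcases lt_trichotomy Z U with hZ | rfl | hZ
  · exact hC.le_of_marginal_le hΨ hU le_rfl (hC.tendsto_toReal_left hfin)
      (fun Y hY hYU => (hlt Y hY hYU).le) hZ0 hZ
  · simp
  · exact absurd (hC.cost_eq_top Z hZ) htop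

/-- A load at which a given continuous function `Ψ` of the average cost is a subgradient. -/
theorem exists_isSubgradient (hC : IsCostFunction U C c) (hU : 0 < U) {Ψ : ℝ → ℝ}
    (hΨ : Continuous Ψ) {W : ℝ} (hW : ∀ a, W ≤ a → Ψ a ≤ a)
    (h0 : (c 0).toReal < Ψ (c 0).toReal) :
    ∃ X, 0 < X ∧ X ≤ U ∧ IsSubgradient C X (Ψ ((C X).toReal / X)) := by
  -- At `X = sInf S` the marginal is below `Ψ` on the left, which gives the bound for `Z < X`;
  -- tangents at points of `S` tending to `X` give the bound for `Z > X`. If `S` is empty, the load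
  -- is `U`.
  set S : Set ℝ := {Y | 0 < Y ∧ Y < U ∧ Ψ ((C Y).toReal / Y) ≤ (c Y).toReal}
  rcases S.eq_empty_or_nonempty with hS | hS
  · refine ⟨U, hU, le_rfl, hC.exists_isSubgradient_of_forall_lt hU hΨ hW fun Y hY hYU => ?_⟩
    by_contra! h
    exact (hS ▸ (⟨hY, hYU, h⟩ : Y ∈ S) : Y ∈ (∅ : Set ℝ))
  have hbdd : BddBelow S := ⟨0, fun Y hY => hY.1.le⟩
  set X : ℝ := sInf S
  have hX0 : 0 ≤ X := le_csInf hS fun Y hY => hY.1.le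
  have hXU : X < U := by
    obtain ⟨Y, hY⟩ := hS
    exact (csInf_le hbdd hY).trans_lt hY.2.1
  have : (𝓝[S] X).NeBot := mem_closure_iff_nhdsWithin_neBot.1 (csInf_mem_closure hS hbdd)
  have hF : Tendsto (fun y => (C y).toReal) (𝓝[S] X) (𝓝 (C X).toReal) :=
    (hC.hasDerivWithinAt X hX0 hXU).continuousWithinAt.mono fun Y hY => hY.1.le
  have hid : Tendsto (fun y : ℝ => y) (𝓝[S] X) (𝓝 X) := nhdsWithin_le_nhds
  have hright : ∀ L, Tendsto (fun y => (C y).toReal / y) (𝓝[S] X) (𝓝 L) →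
      ∀ Z, X < Z → Z < U → (C X).toReal + Ψ L * (Z - X) ≤ (C Z).toReal := by
    intro L hL Z hXZ hZU
    refine le_of_tendsto (hF.add (((hΨ.tendsto L).comp hL).mul (hid.const_sub Z))) ?_
    filter_upwards [self_mem_nhdsWithin, nhdsWithin_le_nhds (Iio_mem_nhds hXZ)] with y hy hyZ
    have h1 := hC.add_marginal_mul_le hy.1.le hy.2.1 (hX0.trans hXZ.le) hZU
    have h2 := mul_le_mul_of_nonneg_right hy.2.2 (sub_pos.2 (show y < Z from hyZ)).le
    simp only [Function.comp_apply]
    linarith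
  rcases hX0.eq_or_lt with hX | hX
  -- At `X = 0` the limit of the averages is `c 0`, and the right bound would give `Ψ (c 0) ≤ c 0`.
  · exfalso
    have h1 := hright (c 0).toReal (by
      rw [← hX]
      exact (hC.tendsto_average_zero hU).mono_left (nhdsWithin_mono _ fun Y hY => hY.1))
    rw [← hX] at h1
    simp only [hC.cost_zero, ENNReal.toReal_zero, zero_add, sub_zero] at h1
    exact h0.not_ge (hC.le_marginal_zero hU h1)
  · refine ⟨X, hX, hXU.le, hC.cost_ne_top X hX0 hXU, fun Z hZ0 htop => ?_⟩
    rcases lt_trichotomy Z X with hZ | rfl | hZ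
    · refine hC.le_of_marginal_le hΨ hX hXU.le ?_ (fun Y hY hYX => ?_) hZ0 hZ
      · exact ((hC.hasDerivWithinAt X hX0 hXU).hasDerivAt
          (Ici_mem_nhds hX)).continuousAt.tendsto.mono_left nhdsWithin_le_nhds
      · by_contra! h
        exact hYX.not_ge (csInf_le hbdd ⟨hY, hYX.trans hXU, h.le⟩)
    · simp
    · exact hC.affine_le hXU (hright _ (hF.div hid hX.ne')) hZ htop

end IsCostFunction

/-! ### From subgradients of the cost to supported slots. -/

theorem load_update (q : Fin N → ℝ) (i : Fin N) (d : ℝ) :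
    load (Function.update q i d) = load q + (d - q i) := by
  rw [load, load, Finset.sum_update_of_mem (Finset.mem_univ i),
    ← Finset.add_sum_erase _ q (Finset.mem_univ i), Finset.sdiff_singleton_eq_erase]
  ring

theorem averageCostPayment_eq_zero {C : ℝ → ℝ≥0∞} {q : Fin N → ℝ} {i : Fin N} (h : q i = 0) :
    averageCostPayment C q i = 0 := by
  simp [averageCostPayment, h]

theorem toReal_averageCostPayment {C : ℝ → ℝ≥0∞} {q : Fin N → ℝ} {i : Fin N} (hq : 0 ≤ q i)
    (hload : 0 ≤ load q) :
    (averageCostPayment C q i).toReal = q i * ((C (load q)).toReal / load q) := by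
  rw [averageCostPayment, averageCost, ENNReal.toReal_mul, ENNReal.toReal_div,
    ENNReal.toReal_ofReal hq, ENNReal.toReal_ofReal hload]

theorem cost_ne_top_of_averageCostPayment_ne_top {C : ℝ → ℝ≥0∞} {q : Fin N → ℝ} {i : Fin N}
    (hq : 0 < q i) (h : averageCostPayment C q i ≠ ⊤) : C (load q) ≠ ⊤ := by
  rintro htop
  refine h ?_
  rw [averageCostPayment, averageCost, htop, ENNReal.top_div_of_ne_top ENNReal.ofReal_ne_top,
    ENNReal.mul_top (ENNReal.ofReal_pos.2 hq).ne']

/-- After `C` is replaced by its supporting line, the gap is a square times non-negative factors. -/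
theorem averageCost_deviation {d q X a κ G : ℝ} (hd : 0 < d) (hqX : q ≤ X) (hX : 0 < X)
    (haκ : a ≤ κ) (hG : X * a + κ * (d - q) ≤ G) :
    q * a + (a + q / X * (κ - a)) * (d - q) ≤ d * (G / (X + (d - q))) := by
  have hZ : 0 < X + (d - q) := by linarith
  have h1 : d * ((X * a + κ * (d - q)) / (X + (d - q))) ≤ d * (G / (X + (d - q))) := by gcongr
  refine le_trans ?_ h1
  have h2 : d * ((X * a + κ * (d - q)) / (X + (d - q))) -
      (q * a + (a + q / X * (κ - a)) * (d - q)) =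
      (κ - a) * (d - q) ^ 2 * (X - q) / (X * (X + (d - q))) := by
    field_simp
    ring
  have h3 : 0 ≤ (κ - a) * (d - q) ^ 2 * (X - q) / (X * (X + (d - q))) :=
    div_nonneg (mul_nonneg (mul_nonneg (sub_nonneg.2 haκ) (sq_nonneg _)) (sub_nonneg.2 hqX))
      (mul_pos hX hZ).le
  linarith

theorem IsSubgradient.average_le {C : ℝ → ℝ≥0∞} {X κ : ℝ} (h : IsSubgradient C X κ)
    (h0 : C 0 = 0) (hX : 0 < X) : (C X).toReal / X ≤ κ := by
  have := h.2 0 le_rfl (by simp [h0])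
  rw [h0, ENNReal.toReal_zero] at this
  rw [div_le_iff₀ hX]
  linarith

theorem isSupported_averageCost {C : ℝ → ℝ≥0∞} {q : Fin N → ℝ} {κ : ℝ} (h0 : C 0 = 0)
    (hq : ∀ i, 0 ≤ q i) (hload : 0 < load q) (hκ : IsSubgradient C (load q) κ) :
    IsSupported (averageCostPayment C) q fun i =>
      (C (load q)).toReal / load q +
        q i / load q * (κ - (C (load q)).toReal / load q) := by
  intro i
  have hle := hκ.average_le h0 hload
  have hqX : q i ≤ load q := Finset.single_le_sum (fun j _ => hq j) (Finset.mem_univ i)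
  refine ⟨?_, fun d hd htop => ?_⟩
  · exact ENNReal.mul_ne_top ENNReal.ofReal_ne_top
      (ENNReal.div_ne_top hκ.1 (ENNReal.ofReal_pos.2 hload).ne')
  rw [toReal_averageCostPayment (hq i) hload.le]
  rcases hd.eq_or_lt with rfl | hd
  -- Withdrawal is separate: the remaining load, a denominator, may be zero.
  · rw [averageCostPayment_eq_zero (Function.update_self ..), ENNReal.toReal_zero]
    have : 0 ≤ q i / load q * (κ - (C (load q)).toReal / load q) * q i :=
      mul_nonneg (mul_nonneg (div_nonneg (hq i) hload.le) (sub_nonneg.2 hle)) (hq i)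
    linarith
  · have hZ : 0 ≤ load q + (d - q i) := by linarith
    have hfin := cost_ne_top_of_averageCostPayment_ne_top (by simpa using hd) htop
    rw [toReal_averageCostPayment (by simpa using hd.le) (by rwa [load_update]),
      Function.update_self]
    rw [load_update] at hfin ⊢
    refine averageCost_deviation hd hqX hload hle ?_
    rw [mul_div_cancel₀ _ hload.ne']
    simpa using hκ.2 _ hZ hfin

/-- A sole consumer pays exactly `C d`, so every slope up to `κ` works. -/
theorem isSupported_averageCost_zero {C : ℝ → ℝ≥0∞} {κ : ℝ} (h0 : C 0 = 0)
    (hκ : IsSubgradient C 0 κ) {lam : Fin N → ℝ} (hlam : ∀ i, lam i ≤ κ) :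
    IsSupported (averageCostPayment C) 0 lam := by
  intro i
  rw [averageCostPayment_eq_zero rfl]
  refine ⟨ENNReal.zero_ne_top, fun d hd htop => ?_⟩
  rcases hd.eq_or_lt with rfl | hd
  · simp
  · have hload : load (Function.update (0 : Fin N → ℝ) i d) = d := by
      rw [load_update]
      simp [load]
    have hfin := cost_ne_top_of_averageCostPayment_ne_top (by simpa using hd) htop
    rw [toReal_averageCostPayment (by simpa using hd.le) (by rw [hload]; exact hd.le), hload,
      Function.update_self, mul_div_cancel₀ _ hd.ne']
    rw [hload] at hfin
    have h1 := hκ.2 d hd.le hfin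
    have h2 := mul_le_mul_of_nonneg_right (hlam i) hd.le
    simp only [h0, ENNReal.toReal_zero, zero_add, sub_zero, Pi.zero_apply] at h1 ⊢
    linarith

/-- The slope of a consumer without demand can be lowered. -/
theorem IsSupported.mono {pay : (Fin N → ℝ) → Fin N → ℝ≥0∞} {q lam lam' : Fin N → ℝ}
    (h : IsSupported pay q lam) (hle : ∀ i, lam' i = lam i ∨ q i = 0 ∧ lam' i ≤ lam i) :
    IsSupported pay q lam' := by
  refine fun i => ⟨(h i).1, fun d hd htop => le_trans ?_ ((h i).2 d hd htop)⟩
  rcases hle i with h' | ⟨h1, h2⟩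
  · rw [h']
  · have := mul_le_mul_of_nonneg_right h2 hd
    rw [h1]
    linarith

theorem exists_averageCost_equilibrium {U : ℝ} (hU : 0 < U) {C c : ℝ → ℝ≥0∞}
    (hC : IsCostFunction U C c) (ω : Fin N → ℝ) :
    ∃ q : Fin N → ℝ, (∀ i, 0 ≤ q i) ∧ load q ≤ U ∧ IsSupported (averageCostPayment C) q ω := by
  by_cases hsmall : ∀ i, ω i ≤ (c 0).toReal
  · exact ⟨0, fun i => le_rfl, by simpa [load] using hU.le,
      isSupported_averageCost_zero hC.cost_zero (hC.isSubgradient_marginal le_rfl hU) hsmall⟩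
  push Not at hsmall
  obtain ⟨k, hk⟩ := hsmall
  set D : ℝ → ℝ := fun a => ∑ i, max 0 (ω i - a)
  have hDpos : ∀ a, a < ω k → 0 < D a := fun a ha =>
    Finset.sum_pos' (fun i _ => le_max_left _ _)
      ⟨k, Finset.mem_univ k, lt_max_of_lt_right (sub_pos.2 ha)⟩
  have hDzero : ∀ a, ∑ i, |ω i| ≤ a → a + D a ≤ a := by
    intro a ha
    have : D a = 0 := Finset.sum_eq_zero fun i _ => max_eq_left <| by
      have := Finset.single_le_sum (fun j _ => abs_nonneg (ω j)) (Finset.mem_univ i)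
      linarith [le_abs_self (ω i)]
    rw [this, add_zero]
  obtain ⟨X, hX0, hXU, hκ⟩ := hC.exists_isSubgradient hU (Ψ := fun a => a + D a)
    (by fun_prop) hDzero (lt_add_of_pos_right _ (hDpos _ hk))
  set a : ℝ := (C X).toReal / X with ha
  have hFX : (C X).toReal = a * X := by rw [ha, div_mul_cancel₀ _ hX0.ne']
  -- If `D a = 0`, the line of slope `a` through the origin lies below `C`, so `a ≤ c 0 < ω k`,
  -- which forces `D a > 0`.
  have hD : 0 < D a := by
    refine (Finset.sum_nonneg fun i _ => le_max_left 0 (ω i - a)).lt_of_ne' fun h => ?_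
    have hle : a ≤ (c 0).toReal := hC.le_marginal_zero hU fun Z hZ hZU => by
      have h1 := hκ.2 Z hZ.le (hC.cost_ne_top Z hZ.le hZU)
      simp only [D] at h1
      rw [h, hFX] at h1
      linarith
    exact (hDpos a (hle.trans_lt hk)).ne' h
  -- Load is shared in proportion to the excess of `ω i` over the average cost; here `κ - a = D a`.
  set q : Fin N → ℝ := fun i => max 0 (ω i - a) / D a * X with hqdef
  have hq : ∀ i, 0 ≤ q i := fun i => mul_nonneg (div_nonneg (le_max_left _ _) hD.le) hX0.le
  have hload : load q = X := by
    rw [load, ← Finset.sum_mul, ← Finset.sum_div, div_self hD.ne', one_mul]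
  refine ⟨q, hq, hload.trans_le hXU, ?_⟩
  refine (isSupported_averageCost hC.cost_zero hq (by rwa [hload])
    (by rwa [hload])).mono fun i => ?_
  have hslope : q i / X * (a + D a - a) = max 0 (ω i - a) := by
    rw [hqdef]
    field_simp
    ring
  rw [hload, ← ha, hslope]
  rcases le_total (ω i) a with h | h
  · have h' : max 0 (ω i - a) = 0 := max_eq_left (sub_nonpos.2 h)
    -- An idle consumer has slope `a ≥ ω i`, which may be lowered to `ω i`.
    exact Or.inr ⟨by simp [hqdef, h'], by rw [h', add_zero]; exact h⟩
  · left
    rw [max_eq_right (sub_nonneg.2 h)]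
    ring

theorem exists_isSupported_averageCost {U : ℝ} {C c : ℝ → ℝ≥0∞} (hC : IsCostFunction U C c)
    {q : Fin N → ℝ} (hq : ∀ i, 0 ≤ q i) (hload : load q < U) :
    ∃ lam : Fin N → ℝ, (∀ i, 0 ≤ lam i) ∧ IsSupported (averageCostPayment C) q lam := by
  have h0 : 0 ≤ load q := Finset.sum_nonneg fun i _ => hq i
  have hκ := hC.isSubgradient_marginal h0 hload
  rcases h0.eq_or_lt with h | h
  · have hq0 : q = 0 := by
      funext i
      exact (Finset.sum_eq_zero_iff_of_nonneg fun i _ => hq i).1 h.symm i (Finset.mem_univ i)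
    rw [← h] at hκ
    rw [hq0]
    exact ⟨0, fun i => le_rfl,
      isSupported_averageCost_zero hC.cost_zero hκ fun i => ENNReal.toReal_nonneg⟩
  · refine ⟨_, fun i => ?_, isSupported_averageCost hC.cost_zero hq h hκ⟩
    exact add_nonneg (div_nonneg ENNReal.toReal_nonneg h0) (mul_nonneg (div_nonneg (hq i) h0)
      (sub_nonneg.2 (hκ.average_le hC.cost_zero h)))

end LoadBalancing

theorem mainTheorem1 (N T : ℕ) (U : ℝ) (C c : ℝ → ℝ≥0∞)
    (hC : LoadBalancing.IsCostFunction U C c) (scheme : LoadBalancing.PricingScheme) :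
    (∀ β : Fin N → ℝ, (∀ i, 0 ≤ β i) → ∑ i, β i < (T : ℝ) * U →
      ∃ x : Fin N → Fin T → ℝ,
        LoadBalancing.IsNEP (scheme.payment C c) LoadBalancing.zeroRevenue β x ∧
        LoadBalancing.IsServable (scheme.payment C c) U x) ∧
    (∀ ω : Fin N → Fin T → ℝ, (∀ i t, 0 ≤ ω i t) → 0 < (T : ℝ) * U →
      ∃ x : Fin N → Fin T → ℝ,
        LoadBalancing.IsNEP (scheme.payment C c) (LoadBalancing.constantRateRevenue ω)
          (fun _ => 0) x ∧
        LoadBalancing.IsServable (scheme.payment C c) U x) := by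
  constructor
  · intro β hβ hsum
    have hT : 0 < T := by
      refine Nat.pos_of_ne_zero ?_
      rintro rfl
      rw [Nat.cast_zero, zero_mul] at hsum
      exact hsum.not_ge (Finset.sum_nonneg fun i _ => hβ i)
    have hT' : (0 : ℝ) < T := Nat.cast_pos.2 hT
    have hq : ∀ i, 0 ≤ β i / T := fun i => div_nonneg (hβ i) hT'.le
    have hload : LoadBalancing.load (fun i => β i / T) < U := by
      rw [LoadBalancing.load, ← Finset.sum_div, div_lt_iff₀ hT']
      linarith
    obtain ⟨lam, hlam, hs⟩ : ∃ lam : Fin N → ℝ, (∀ i, 0 ≤ lam i) ∧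
        LoadBalancing.IsSupported (scheme.payment C c) (fun i => β i / T) lam := by
      cases scheme
      · exact LoadBalancing.exists_isSupported_averageCost hC hq hload
      · exact LoadBalancing.exists_isSupported_increasingBlock hC hq hload
    exact LoadBalancing.exists_zeroRevenue_nep hT hβ hsum hlam hs
  · intro ω hω hTU
    have hU : 0 < U := pos_of_mul_pos_right hTU (Nat.cast_nonneg T)
    refine LoadBalancing.exists_constantRate_nep fun t => ?_
    cases scheme
    · exact LoadBalancing.exists_averageCost_equilibrium hU hC _
    · exact LoadBalancing.exists_increasingBlock_equilibrium hU hC.marginal_mono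
        hC.marginal_eq_top fun i => hω i t
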